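/- Let $\varepsilon>0$ and let $(\mathcal X,d)$ be a proper metric space (closed bounded sets are compact) with its Borel $\sigma$-algebra. Write $B_\varepsilon(x)$ and $\overline B_\varepsilon(x)$ for open and closed balls. Assume that for all $x\in\mathcal X$ and $0<r<\varepsilon$ there is a measurable map $T_{x,r}\colon\overline B_\varepsilon(x)\to\overline B_{\varepsilon-r}(x)$ with $d(T_{x,r}(y),y)\le r$ for all $y\in\overline B_\varepsilon(x)$. Let $\mu$ be a Borel probability measure on $\mathcal X\times\{0,1\}$, $\rho_i:=\mu(\,\cdot\times\{i\})$ for $i\in\{0,1\}$, and $\rho:=\rho_0+\rho_1$. A random walk $\mathbf m=(m_x)_{x\in\mathcal X}$ is a family of Borel probability measures on $\mathcal X$ such that $x\mapsto m_x(A)$ is Borel for every Borel set $A$ and, for some $x_0\in\mathcal X$, $\int d(x_0,y)\,dm_x(y)<\infty$ for all $x$. Let $\mathfrak M$ be the set of random walks with $\operatorname{supp} m_x\subset\overline B_\varepsilon(x)$ for $\rho$-a.e. $x$. For continuous $u\colon\mathcal X\to\mathbb R$ set $\nabla_\varepsilon[u](x,y):=\frac{u(y)-u(x)}{\varepsilon}$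 and $$\mathrm{TV}_\varepsilon(u):=\int_{\mathcal X}\frac{\max_{\overline B_\varepsilon(x)}u-u(x)}{\varepsilon}\,d\rho_0(x)+\int_{\mathcal X}\frac{u(x)-\min_{\overline B_\varepsilon(x)}u}{\varepsilon}\,d\rho_1(x)\in[0,\infty].$$ For $\underline{\mathbf m}=(\mathbf m^0,\mathbf m^1)$ let $n_x:=\frac12(m^0_x+m^1_x)$, $$[\underline{\mathbf m};\boldsymbol\rho](x,y):=\frac{d\rho_0}{d\rho}(x)\frac{dm^0_x}{dn_x}(y)-\frac{d\rho_1}{d\rho}(x)\frac{dm^1_x}{dn_x}(y)$$ (with jointly measurable versions of the densities $dm^i_x/dn_x$), and let $\operatorname{div}^{\boldsymbol\rho}_\varepsilon[\underline{\mathbf m}]:=\operatorname{div}^{\rho_0}_\varepsilon[\mathbf m^0]-\operatorname{div}^{\rho_1}_\varepsilon[\mathbf m^1]$, where $\operatorname{div}^{\rho_i}_\varepsilon[\mathbf m]$ is the finite signed measure $$\operatorname{div}^{\rho_i}_\varepsilon[\mathbf m](A):=\frac1\varepsilon\Big(\int_A m_x(\mathcal X)\,d\rho_i(x)-\int_{\mathcal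 X}m_x(A)\,d\rho_i(x)\Big).$$ Then for every $u\in C(\mathcal X)$ the following hold, where outer integrals take values in $[-\infty,\infty]$ and $\infty-\infty:=-\infty$ (this case can only occur if $\mathrm{TV}_\varepsilon(u)=\infty$). 1. If $\nu$ is a $\sigma$-finite Borel measure on $\mathcal X$ with $\rho_0,\rho_1\ll\nu$ and $\{x:\operatorname{dist}(x,\operatorname{supp}\rho_i)\le\varepsilon\}\subset\operatorname{supp}\nu$ for $i\in\{0,1\}$, then $$\int_{\mathcal X}\frac{\nu\text{-}\operatorname{ess\,sup}_{B_\varepsilon(x)}u-u(x)}{\varepsilon}\,d\rho_0(x)+\int_{\mathcal X}\frac{u(x)-\nu\text{-}\operatorname{ess\,inf}_{B_\varepsilon(x)}u}{\varepsilon}\,d\rho_1(x)=\mathrm{TV}_\varepsilon(u).$$ 2. $\displaystyle\mathrm{TV}_\varepsilon(u)=\max_{\underline{\mathbf m}\in\mathfrak M\times\mathfrak M}\ \int_{\mathcal X}\int_{\mathcal X}\nabla_\varepsilon[u](x,y)\,dm^0_x(y)\,d\rho_0(x)+\int_{\mathcal X}\int_{\mathcal X}-\nabla_\varepsilon[u](x,y)\,dm^1_x(y)\,d\rho_1(x).$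 3. $\displaystyle\mathrm{TV}_\varepsilon(u)=\max_{\underline{\mathbf m}\in\mathfrak M\times\mathfrak M}\ \int_{\mathcal X}\int_{\mathcal X}\nabla_\varepsilon[u](x,y)\,[\underline{\mathbf m};\boldsymbol\rho](x,y)\,dn_x(y)\,d\rho(x).$ For every bounded continuous $u\in C_b(\mathcal X)$, moreover, $$\mathrm{TV}_\varepsilon(u)=\max_{\underline{\mathbf m}\in\mathfrak M\times\mathfrak M}\ -\int_{\mathcal X}u\,d\operatorname{div}^{\boldsymbol\rho}_\varepsilon[\underline{\mathbf m}].$$ All maxima are attained. -/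

import Mathlib

open MeasureTheory ProbabilityTheory Set
open scoped ENNReal BoundedContinuousFunction

noncomputable section

namespace AdvTV

/-- The shrinking-map assumption at radius `ε`: every closed ball of radius `ε` is mapped
measurably into the concentric closed ball of radius `ε - r`, moving no point by more than `r`. -/
def ShrinkingMaps (X : Type*) [MetricSpace X] [MeasurableSpace X] (ε : ℝ) : Prop :=
  ∀ (x : X) (r : ℝ), 0 < r → r < ε →
    ∃ T : Metric.closedBall x ε → Metric.closedBall x (ε - r),
      Measurable T ∧ ∀ y, dist (T y : X) (y : X) ≤ r

/-- The (un-normalized) class-conditional distribution `μ(· × {i})`. -/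
def classCond {X : Type*} [MeasurableSpace X] (μ : Measure (X × Fin 2)) (i : Fin 2) : Measure X :=
  (μ.restrict (univ ×ˢ {i})).map Prod.fst

theorem classCond_apply {X : Type*} [MeasurableSpace X] (μ : Measure (X × Fin 2)) (i : Fin 2)
    {A : Set X} (hA : MeasurableSet A) : classCond μ i A = μ (A ×ˢ {i}) := by
  rw [classCond, Measure.map_apply measurable_fst hA,
    Measure.restrict_apply (measurable_fst hA)]
  congr 1
  ext p
  simp

instance {X : Type*} [MeasurableSpace X] (μ : Measure (X × Fin 2)) [IsFiniteMeasure μ]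
    (i : Fin 2) : IsFiniteMeasure (classCond μ i) := by
  unfold classCond
  infer_instance

/-- The dominating measure `ρ = ρ₀ + ρ₁`. -/
def total {X : Type*} [MeasurableSpace X] (μ : Measure (X × Fin 2)) : Measure X :=
  classCond μ 0 + classCond μ 1

/-- The Lebesgue integral with values in `[-∞, ∞]`: the integral of the positive part minus the
integral of the negative part, which is the usual one unless both are infinite. -/
def extIntegral {X : Type*} [MeasurableSpace X] (ρ : Measure X) (f : X → ℝ) : EReal :=
  ((∫⁻ x, ENNReal.ofReal (f x) ∂ρ : ℝ≥0∞) : EReal)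
    - ((∫⁻ x, ENNReal.ofReal (-f x) ∂ρ : ℝ≥0∞) : EReal)

/-- The adversarial total variation of a continuous function: maximum and minimum are taken
over closed balls, which are compact in a proper space. -/
def advTV {X : Type*} [MetricSpace X] [MeasurableSpace X] (ε : ℝ) (μ : Measure (X × Fin 2))
    (u : X → ℝ) : EReal :=
  extIntegral (classCond μ 0) (fun x => (sSup (u '' Metric.closedBall x ε) - u x) / ε)
    + extIntegral (classCond μ 1) (fun x => (u x - sInf (u '' Metric.closedBall x ε)) / ε)

/-- The adversarial total variation relative to a reference measure `ν`, with essential suprema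
and infima over open balls. -/
def refTV {X : Type*} [MetricSpace X] [MeasurableSpace X] (ε : ℝ) (μ : Measure (X × Fin 2))
    (ν : Measure X) (u : X → ℝ) : EReal :=
  extIntegral (classCond μ 0) (fun x => (essSup u (ν.restrict (Metric.ball x ε)) - u x) / ε)
    + extIntegral (classCond μ 1)
        (fun x => (u x - essInf u (ν.restrict (Metric.ball x ε))) / ε)

/-- Admissible reference measures: σ-finite, dominating both class-conditional distributions, and
with the closed `ε`-neighbourhoods of their supports contained in the support of `ν`. (Local
doubling of `ν` is not required.) -/
structure IsReferenceMeasure {X : Type*} [MetricSpace X] [MeasurableSpace X] (ε : ℝ)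
    (μ : Measure (X × Fin 2)) (ν : Measure X) : Prop where
  sigmaFinite : SigmaFinite ν
  absolutelyContinuous : ∀ i, classCond μ i ≪ ν
  support_subset : ∀ i, Metric.cthickening ε (classCond μ i).support ⊆ ν.support

/-- A random walk: a family of probability measures `m_x`, depending measurably on `x`, each
with finite first moment. -/
structure RandomWalk (X : Type*) [MetricSpace X] [MeasurableSpace X] where
  toKernel : Kernel X X
  isMarkov : IsMarkovKernel toKernel
  firstMoment : ∃ x₀ : X, ∀ x, ∫⁻ y, edist x₀ y ∂(toKernel x) < ∞

attribute [instance] RandomWalk.isMarkov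

/-- The test random walks: `supp m_x` lies in the closed `ε`-ball around `x` for
`ρ`-almost every `x`. -/
def testWalks {X : Type*} [MetricSpace X] [MeasurableSpace X] (ε : ℝ) (ρ : Measure X) :
    Set (RandomWalk X) :=
  {m | ∀ᵐ x ∂ρ, (m.toKernel x).support ⊆ Metric.closedBall x ε}

/-- The nonlocal gradient. -/
def grad {X : Type*} (ε : ℝ) (u : X → ℝ) (x y : X) : ℝ := (u y - u x) / ε

/-- The random walk `n_x = (m⁰_x + m¹_x) / 2`. -/
def avgWalk {X : Type*} [MetricSpace X] [MeasurableSpace X] [BorelSpace X]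
    (m₀ m₁ : RandomWalk X) : RandomWalk X where
  toKernel :=
    { toFun := fun x => (2 : ℝ≥0∞)⁻¹ • (m₀.toKernel x + m₁.toKernel x)
      measurable' := by
        refine Measure.measurable_of_measurable_coe _ fun s hs => ?_
        simp only [Measure.smul_apply, Measure.add_apply, smul_eq_mul]
        exact ((m₀.toKernel.measurable_coe hs).add
          (m₁.toKernel.measurable_coe hs)).const_mul _ }
  isMarkov := ⟨fun x => ⟨by
    change ((2 : ℝ≥0∞)⁻¹ • (m₀.toKernel x + m₁.toKernel x)) univ = 1
    simp only [Measure.smul_apply, Measure.add_apply, measure_univ, smul_eq_mul]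
    rw [one_add_one_eq_two]
    exact ENNReal.inv_mul_cancel (by simp) (by simp)⟩⟩
  firstMoment := by
    obtain ⟨a, ha⟩ := m₀.firstMoment
    obtain ⟨b, hb⟩ := m₁.firstMoment
    refine ⟨a, fun x => ?_⟩
    change ∫⁻ y, edist a y ∂((2 : ℝ≥0∞)⁻¹ • (m₀.toKernel x + m₁.toKernel x)) < ∞
    rw [lintegral_smul_measure, lintegral_add_measure]
    refine ENNReal.mul_lt_top (by simp) (ENNReal.add_lt_top.2 ⟨ha x, ?_⟩)
    calc ∫⁻ y, edist a y ∂(m₁.toKernel x)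
        ≤ ∫⁻ y, (edist a b + edist b y) ∂(m₁.toKernel x) :=
          lintegral_mono fun y => edist_triangle a b y
      _ = edist a b + ∫⁻ y, edist b y ∂(m₁.toKernel x) := by
          rw [lintegral_add_left measurable_const]; simp
      _ < ∞ := ENNReal.add_lt_top.2 ⟨edist_lt_top a b, hb x⟩

/-- The jointly measurable density
`[m; ρ](x, y) = (dρ₀/dρ)(x) (dm⁰_x/dn_x)(y) - (dρ₁/dρ)(x) (dm¹_x/dn_x)(y)`. -/
def density {X : Type*} [MetricSpace X] [ProperSpace X] [MeasurableSpace X] [BorelSpace X]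
    (μ : Measure (X × Fin 2)) (m₀ m₁ : RandomWalk X) (x y : X) : ℝ :=
  ((classCond μ 0).rnDeriv (total μ) x).toReal
      * (Kernel.rnDeriv m₀.toKernel (avgWalk m₀ m₁).toKernel x y).toReal
    - ((classCond μ 1).rnDeriv (total μ) x).toReal
      * (Kernel.rnDeriv m₁.toKernel (avgWalk m₀ m₁).toKernel x y).toReal

/-- The nonlocal divergence of a random walk weighted by a finite measure; its values on Borel
sets are given by `walkDiv_apply`. -/
def walkDiv {X : Type*} [MetricSpace X] [MeasurableSpace X] (ε : ℝ) (ρ : Measure X)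
    [IsFiniteMeasure ρ] (m : RandomWalk X) : SignedMeasure X :=
  ε⁻¹ • (ρ.toSignedMeasure - (ρ.bind m.toKernel).toSignedMeasure)

theorem walkDiv_apply {X : Type*} [MetricSpace X] [MeasurableSpace X] (ε : ℝ) (ρ : Measure X)
    [IsFiniteMeasure ρ] (m : RandomWalk X) {A : Set X} (hA : MeasurableSet A) :
    walkDiv ε ρ m A =
      ((∫ x in A, (m.toKernel x).real univ ∂ρ) - ∫ x, (m.toKernel x).real A ∂ρ) / ε := by
  have h : (ρ.bind m.toKernel).real A = ∫ x, (m.toKernel x).real A ∂ρ := by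
    rw [Measure.real, Measure.bind_apply hA m.toKernel.measurable.aemeasurable]
    simp only [Measure.real]
    rw [integral_toReal (m.toKernel.measurable_coe hA).aemeasurable
      (Filter.Eventually.of_forall fun x => measure_lt_top _ _)]
  have h' : (∫ x in A, (m.toKernel x).real univ ∂ρ) = ρ.real A := by simp
  rw [← h, h', walkDiv, div_eq_inv_mul]
  simp [hA]

/-- The nonlocal divergence of a pair of random walks. -/
def pairDiv {X : Type*} [MetricSpace X] [MeasurableSpace X] (ε : ℝ) (μ : Measure (X × Fin 2))
    [IsFiniteMeasure μ] (m₀ m₁ : RandomWalk X) : SignedMeasure X :=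
  walkDiv ε (classCond μ 0) m₀ - walkDiv ε (classCond μ 1) m₁

end AdvTV

end

/-! For a random walk with `supp m_x` in the closed `ε`-ball around `x`, the average of the
difference quotients `(u y - u x) / ε` against `m_x` is at most their maximum over that ball, with
equality when `m_x` is the Dirac mass at a maximizer. Hence the supremum over random walks is the
integral of the maximum, and it is attained as soon as a maximizer can be selected measurably in
`x`. To select one, minimize successively a sequence of continuous functions separating the points
of `X` over the compact set of maximizers: a single point survives, and whether it lies in a given
closed set is a countable condition on `x`. The part involving `ρ₁` is the same statement for `-u`.

The formulation with `[m; ρ]` is a change of density, since `m⁰_x` and `m¹_x` are absolutely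
continuous with respect to `n_x`, and the one with the divergence is Fubini's theorem. The shrinking
maps show that a closed ball lies in the closure of the open ball of the same radius, so that the
maximum of a continuous function over the former is its essential supremum over the latter. -/

namespace AdvTV

section Correspondence

variable {X Y : Type*}

/-- The set of minimizers of `g` on `K`. -/
def argminSet (g : Y → ℝ) (K : Set Y) : Set Y :=
  {y ∈ K | ∀ z ∈ K, g y ≤ g z}

variable {g : Y → ℝ} {K : Set Y}

theorem argminSet_subset : argminSet g K ⊆ K :=
  fun _ hy => hy.1

theorem eq_of_mem_argminSet {y z : Y} (hy : y ∈ argminSet g K)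
    (hz : z ∈ argminSet g K) : g y = g z :=
  le_antisymm (hy.2 z hz.1) (hz.2 y hy.1)

theorem argminSet_eq_inter {y : Y} (hy : y ∈ argminSet g K) :
    argminSet g K = K ∩ {z | g z ≤ g y} :=
  Subset.antisymm (fun _ hz => ⟨hz.1, (eq_of_mem_argminSet hz hy).le⟩)
    fun _ hz => ⟨hz.1, fun w hw => le_trans hz.2 (hy.2 w hw)⟩

/-- Successive minimization: among the points of `K` keep those minimizing `f 0`, among these
those minimizing `f 1`, and so on, up to `f (n - 1)`. -/
def lexArgmin (f : ℕ → Y → ℝ) (K : Set Y) : ℕ → Set Y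
  | 0 => K
  | n + 1 => argminSet (f n) (lexArgmin f K n)

theorem subsingleton_iInter_lexArgmin {f : ℕ → Y → ℝ}
    (hf : Function.Injective fun y n => f n y) (K : Set Y) :
    (⋂ n, lexArgmin f K n).Subsingleton := fun _ hy _ hz =>
  hf <| funext fun n => eq_of_mem_argminSet (mem_iInter.1 hy (n + 1)) (mem_iInter.1 hz (n + 1))

variable [TopologicalSpace Y]

theorem argminSet_nonempty (hK : IsCompact K) (hne : K.Nonempty) (hg : Continuous g) :
    (argminSet g K).Nonempty := by
  obtain ⟨y, hy, hmin⟩ := hK.exists_isMinOn hne hg.continuousOn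
  exact ⟨y, hy, isMinOn_iff.1 hmin⟩

theorem isCompact_argminSet (hK : IsCompact K) (hg : Continuous g) :
    IsCompact (argminSet g K) := by
  obtain hempty | ⟨y, hy⟩ := (argminSet g K).eq_empty_or_nonempty
  · exact hempty ▸ isCompact_empty
  · exact argminSet_eq_inter hy ▸ hK.inter_right (isClosed_le hg continuous_const)

theorem argminSet_inter_nonempty_iff (hK : IsCompact K) (hg : Continuous g) {C : Set Y}
    (hC : IsClosed C) :
    (argminSet g K ∩ C).Nonempty ↔ (K ∩ C).Nonempty ∧
      ∀ q : ℚ, (K ∩ {y | g y ≤ q}).Nonempty → (K ∩ (C ∩ {y | g y ≤ q})).Nonempty := by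
  constructor
  · rintro ⟨y, ⟨hyK, hmin⟩, hyC⟩
    exact ⟨⟨y, hyK, hyC⟩, fun q ⟨z, hzK, hzq⟩ => ⟨y, hyK, hyC, (hmin z hzK).trans hzq⟩⟩
  · rintro ⟨hne, hq⟩
    obtain ⟨y, ⟨hyK, hyC⟩, hmin⟩ := argminSet_nonempty (hK.inter_right hC) hne hg
    refine ⟨y, ⟨hyK, fun z hzK => ?_⟩, hyC⟩
    by_contra! hlt
    obtain ⟨q, hzq, hqy⟩ := exists_rat_btwn hlt
    obtain ⟨w, hwK, hwC, hwq⟩ := hq q ⟨z, hzK, hzq.le⟩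
    exact hqy.not_ge ((hmin w ⟨hwK, hwC⟩).trans hwq)

/-- A correspondence `x ↦ F x` with nonempty compact values that is measurable in the sense of
closed sets: the set of `x` whose value meets a given closed set is measurable. -/
structure IsMeasurableCorrespondence [MeasurableSpace X] (F : X → Set Y) : Prop where
  isCompact : ∀ x, IsCompact (F x)
  nonempty : ∀ x, (F x).Nonempty
  measurable_inter_nonempty : ∀ C, IsClosed C → Measurable fun x => (F x ∩ C).Nonempty

namespace IsMeasurableCorrespondence

variable [MeasurableSpace X] {F : X → Set Y} {f : ℕ → Y → ℝ}

protected theorem argminSet (hF : IsMeasurableCorrespondence F) (hg : Continuous g) :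
    IsMeasurableCorrespondence fun x => argminSet g (F x) where
  isCompact x := isCompact_argminSet (hF.isCompact x) hg
  nonempty x := argminSet_nonempty (hF.isCompact x) (hF.nonempty x) hg
  measurable_inter_nonempty C hC := by
    have hsublevel (q : ℚ) : IsClosed {y | g y ≤ q} := isClosed_le hg continuous_const
    simp only [fun x => argminSet_inter_nonempty_iff (hF.isCompact x) hg hC]
    exact (hF.measurable_inter_nonempty C hC).and <| .forall fun q =>
      (hF.measurable_inter_nonempty _ (hsublevel q)).imp
        (hF.measurable_inter_nonempty _ (hC.inter (hsublevel q)))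

protected theorem lexArgmin (hF : IsMeasurableCorrespondence F) (hf : ∀ n, Continuous (f n))
    (n : ℕ) : IsMeasurableCorrespondence fun x => lexArgmin f (F x) n := by
  induction n with
  | zero => exact hF
  | succ n ih => exact ih.argminSet (hf n)

theorem iInter_lexArgmin_inter_nonempty_iff [T2Space Y] (hF : IsMeasurableCorrespondence F)
    (hf : ∀ n, Continuous (f n)) {C : Set Y} (hC : IsClosed C) (x : X) :
    ((⋂ n, lexArgmin f (F x) n) ∩ C).Nonempty ↔
      ∀ n, (lexArgmin f (F x) n ∩ C).Nonempty := by
  refine ⟨fun h n => h.mono (inter_subset_inter_left C (iInter_subset _ n)), fun h => ?_⟩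
  have hcompact (n : ℕ) : IsCompact (lexArgmin f (F x) n) := (hF.lexArgmin hf n).isCompact x
  rw [iInter_inter]
  exact IsCompact.nonempty_iInter_of_sequence_nonempty_isCompact_isClosed _
    (fun n => inter_subset_inter_left C argminSet_subset) h
    ((hcompact 0).inter_right hC) fun n => (hcompact n).isClosed.inter hC

theorem exists_measurable_selection_of_injective [T2Space Y] [MeasurableSpace Y] [BorelSpace Y]
    (hF : IsMeasurableCorrespondence F) (hf : ∀ n, Continuous (f n))
    (hinj : Function.Injective fun y n => f n y) :
    ∃ T : X → Y, Measurable T ∧ ∀ x, T x ∈ F x := by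
  have hne (x : X) : (⋂ n, lexArgmin f (F x) n).Nonempty := by
    simpa only [inter_univ] using (hF.iInter_lexArgmin_inter_nonempty_iff hf isClosed_univ x).2
      fun n => by simpa only [inter_univ] using (hF.lexArgmin hf n).nonempty x
  choose T hT using hne
  have hpreimage (x : X) (C : Set Y) :
      T x ∈ C ↔ ((⋂ n, lexArgmin f (F x) n) ∩ C).Nonempty := by
    refine ⟨fun h => ⟨T x, hT x, h⟩, fun ⟨y, hy, hyC⟩ => ?_⟩
    rwa [subsingleton_iInter_lexArgmin hinj (F x) (hT x) hy]
  refine ⟨T, measurable_of_isClosed fun C hC => ?_, fun x => mem_iInter.1 (hT x) 0⟩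
  refine measurableSet_setOfPred.2 ?_
  simp only [hpreimage, hF.iInter_lexArgmin_inter_nonempty_iff hf hC]
  exact .forall fun n => (hF.lexArgmin hf n).measurable_inter_nonempty C hC

theorem exists_measurable_selection {Y : Type*} [MetricSpace Y]
    [TopologicalSpace.SeparableSpace Y] [MeasurableSpace Y] [BorelSpace Y] {F : X → Set Y}
    (hF : IsMeasurableCorrespondence F) : ∃ T : X → Y, Measurable T ∧ ∀ x, T x ∈ F x := by
  obtain ⟨e, he⟩ := Metric.PiNatEmbed.exists_embedding_to_hilbert_cube (X := Y)
  refine hF.exists_measurable_selection_of_injective (f := fun n y => (e y n : ℝ))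
    (fun n => continuous_subtype_val.comp ((continuous_apply n).comp he.continuous)) ?_
  exact fun y z h => he.injective (funext fun n => Subtype.ext (congrFun h n))

end IsMeasurableCorrespondence

theorem isMeasurableCorrespondence_closedBall [MetricSpace X] [ProperSpace X] [MeasurableSpace X]
    [BorelSpace X] {ε : ℝ} (hε : 0 ≤ ε) :
    IsMeasurableCorrespondence fun x : X => Metric.closedBall x ε where
  isCompact x := isCompact_closedBall x ε
  nonempty _ := Metric.nonempty_closedBall.2 hε
  measurable_inter_nonempty C hC := by
    refine measurableSet_setOfPred.1 ?_
    convert (Metric.isClosed_cthickening (δ := ε) (E := C)).measurableSet using 1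
    ext x
    simp only [hC.cthickening_eq_biUnion_closedBall hε, mem_iUnion₂, exists_prop, Set.Nonempty,
      mem_inter_iff, mem_ofPred_eq, Metric.mem_closedBall_comm (x := x), and_comm]

end Correspondence

section ExtIntegral

variable {X : Type*} [MeasurableSpace X] {ρ ρ₀ : Measure X} {f g : X → ℝ}

theorem extIntegral_mono_ae (h : f ≤ᵐ[ρ] g) : extIntegral ρ f ≤ extIntegral ρ g := by
  refine EReal.sub_le_sub (EReal.coe_ennreal_le_coe_ennreal_iff.2 (lintegral_mono_ae ?_))
    (EReal.coe_ennreal_le_coe_ennreal_iff.2 (lintegral_mono_ae ?_))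
  · exact h.mono fun _ hx => ENNReal.ofReal_le_ofReal hx
  · exact h.mono fun _ hx => ENNReal.ofReal_le_ofReal (neg_le_neg hx)

theorem extIntegral_congr_ae (h : f =ᵐ[ρ] g) : extIntegral ρ f = extIntegral ρ g :=
  le_antisymm (extIntegral_mono_ae h.le) (extIntegral_mono_ae h.symm.le)

theorem extIntegral_of_nonneg (h : 0 ≤ f) :
    extIntegral ρ f = ((∫⁻ x, ENNReal.ofReal (f x) ∂ρ : ℝ≥0∞) : EReal) := by
  have hneg (x : X) : ENNReal.ofReal (-f x) = 0 := ENNReal.ofReal_of_nonpos (neg_nonpos.2 (h x))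
  simp [extIntegral, hneg]

theorem extIntegral_of_integrable (h : Integrable f ρ) :
    extIntegral ρ f = ((∫ x, f x ∂ρ : ℝ) : EReal) := by
  have hneg : ∫⁻ x, ENNReal.ofReal (-f x) ∂ρ ≠ ∞ := h.neg.lintegral_lt_top.ne
  rw [extIntegral, integral_eq_lintegral_pos_part_sub_lintegral_neg_part h, EReal.coe_sub,
    EReal.coe_ennreal_toReal h.lintegral_lt_top.ne, EReal.coe_ennreal_toReal hneg]

theorem extIntegral_add_of_nonneg (hf : 0 ≤ f) (hg : 0 ≤ g) (hfm : AEMeasurable f ρ) :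
    extIntegral ρ (f + g) = extIntegral ρ f + extIntegral ρ g := by
  rw [extIntegral_of_nonneg hf, extIntegral_of_nonneg hg, extIntegral_of_nonneg (add_nonneg hf hg),
    ← EReal.coe_ennreal_add, ← lintegral_add_left' hfm.ennreal_ofReal]
  simp only [Pi.add_apply, ENNReal.ofReal_add (hf _) (hg _)]

theorem extIntegral_rnDeriv_mul [SigmaFinite ρ₀] [ρ₀.HaveLebesgueDecomposition ρ] (hρ : ρ₀ ≪ ρ)
    (hf : AEMeasurable f ρ) :
    extIntegral ρ (fun x => (ρ₀.rnDeriv ρ x).toReal * f x) = extIntegral ρ₀ f := by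
  have hlintegral {g : X → ℝ} (hg : AEMeasurable g ρ) :
      ∫⁻ x, ENNReal.ofReal ((ρ₀.rnDeriv ρ x).toReal * g x) ∂ρ =
        ∫⁻ x, ENNReal.ofReal (g x) ∂ρ₀ := by
    rw [← lintegral_rnDeriv_mul hρ hg.ennreal_ofReal]
    refine lintegral_congr_ae ?_
    filter_upwards [ρ₀.rnDeriv_ne_top ρ] with x hx
    rw [ENNReal.ofReal_mul ENNReal.toReal_nonneg, ENNReal.ofReal_toReal hx]
  simp only [extIntegral, ← mul_neg]
  rw [hlintegral hf, hlintegral hf.fun_neg]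

end ExtIntegral

section EssSup

variable {X : Type*} [TopologicalSpace X] [MeasurableSpace X] [OpensMeasurableSpace X]
  {ν : Measure X} {U : Set X} {u : X → ℝ} {s : ℝ}

theorem ae_restrict_mem_iff_subset (hU : IsOpen U) (hUν : U ⊆ ν.support) {C : Set X}
    (hC : IsClosed C) : (∀ᵐ y ∂ν.restrict U, y ∈ C) ↔ U ⊆ C := by
  refine ⟨fun h y hyU => ?_, fun h => (ae_restrict_mem hU.measurableSet).mono fun _ hy => h hy⟩
  by_contra hyC
  have hpos : 0 < ν (U ∩ Cᶜ) :=
    (Measure.mem_support_iff_forall y).1 (hUν hyU) _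
      ((hU.inter hC.isOpen_compl).mem_nhds ⟨hyU, hyC⟩)
  refine hpos.ne' ?_
  rw [inter_comm, ← Measure.restrict_apply hC.measurableSet.compl]
  exact h

theorem essSup_restrict_eq_of_isLUB (hU : IsOpen U) (hUν : U ⊆ ν.support) (hu : Continuous u)
    (h : IsLUB (u '' U) s) : essSup u (ν.restrict U) = s := by
  have hbounds : {a | ∀ᵐ y ∂ν.restrict U, u y ≤ a} = upperBounds (u '' U) := by
    ext a
    rw [mem_upperBounds, forall_mem_image]
    exact ae_restrict_mem_iff_subset hU hUν (isClosed_le hu continuous_const)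
  rw [essSup, Filter.limsup_eq, hbounds, h.csInf_eq]

theorem essInf_restrict_eq_of_isGLB (hU : IsOpen U) (hUν : U ⊆ ν.support) (hu : Continuous u)
    (h : IsGLB (u '' U) s) : essInf u (ν.restrict U) = s := by
  have hbounds : {a | ∀ᵐ y ∂ν.restrict U, a ≤ u y} = lowerBounds (u '' U) := by
    ext a
    rw [mem_lowerBounds, forall_mem_image]
    exact ae_restrict_mem_iff_subset hU hUν (isClosed_le continuous_const hu)
  rw [essInf, Filter.liminf_eq, hbounds, h.csSup_eq]

end EssSup

section Reference

variable {X : Type*} [MetricSpace X] {ε : ℝ} {x : X} {u : X → ℝ}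

theorem ShrinkingMaps.closedBall_subset_closure_ball [MeasurableSpace X]
    (hT : ShrinkingMaps X ε) (hε : 0 < ε) (x : X) :
    Metric.closedBall x ε ⊆ closure (Metric.ball x ε) := by
  intro y hy
  refine Metric.mem_closure_iff.2 fun δ hδ => ?_
  obtain ⟨r, hr, hrlt⟩ := exists_between (lt_min hδ hε)
  obtain ⟨T, -, hdist⟩ := hT x r hr (hrlt.trans_le (min_le_right δ ε))
  refine ⟨T ⟨y, hy⟩, ?_, ?_⟩
  · exact Metric.closedBall_subset_ball (sub_lt_self ε hr) (T ⟨y, hy⟩).2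
  · rw [dist_comm]
    exact (hdist ⟨y, hy⟩).trans_lt (hrlt.trans_le (min_le_left δ ε))

theorem image_closedBall_subset_closure_image_ball (hu : Continuous u)
    (hx : Metric.closedBall x ε ⊆ closure (Metric.ball x ε)) :
    u '' Metric.closedBall x ε ⊆ closure (u '' Metric.ball x ε) :=
  (image_mono hx).trans (image_closure_subset_closure_image hu)

theorem ae_ball_subset_of_cthickening_support_subset [SecondCountableTopology X]
    [MeasurableSpace X] {ρ : Measure X} {S : Set X} (h : Metric.cthickening ε ρ.support ⊆ S) :
    ∀ᵐ x ∂ρ, Metric.ball x ε ⊆ S := by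
  filter_upwards [ρ.support_mem_ae] with x hx y hy
  exact h (Metric.mem_cthickening_of_dist_le y x ε _ hx (Metric.mem_ball.1 hy).le)

variable [ProperSpace X]

theorem isLUB_image_closedBall (hε : 0 ≤ ε) (hu : Continuous u) :
    IsLUB (u '' Metric.closedBall x ε) (sSup (u '' Metric.closedBall x ε)) :=
  isLUB_csSup ((Metric.nonempty_closedBall.2 hε).image u)
    ((isCompact_closedBall x ε).image hu).bddAbove

theorem isGLB_image_closedBall (hε : 0 ≤ ε) (hu : Continuous u) :
    IsGLB (u '' Metric.closedBall x ε) (sInf (u '' Metric.closedBall x ε)) :=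
  isGLB_csInf ((Metric.nonempty_closedBall.2 hε).image u)
    ((isCompact_closedBall x ε).image hu).bddBelow

variable [MeasurableSpace X] [BorelSpace X] {ν : Measure X}

theorem essSup_restrict_ball_eq_sSup (hε : 0 ≤ ε) (hu : Continuous u)
    (hx : Metric.closedBall x ε ⊆ closure (Metric.ball x ε))
    (hν : Metric.ball x ε ⊆ ν.support) :
    essSup u (ν.restrict (Metric.ball x ε)) = sSup (u '' Metric.closedBall x ε) :=
  essSup_restrict_eq_of_isLUB Metric.isOpen_ball hν hu <|
    (isLUB_iff_of_subset_of_subset_closure (image_mono Metric.ball_subset_closedBall)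
      (image_closedBall_subset_closure_image_ball hu hx)).2 (isLUB_image_closedBall hε hu)

theorem essInf_restrict_ball_eq_sInf (hε : 0 ≤ ε) (hu : Continuous u)
    (hx : Metric.closedBall x ε ⊆ closure (Metric.ball x ε))
    (hν : Metric.ball x ε ⊆ ν.support) :
    essInf u (ν.restrict (Metric.ball x ε)) = sInf (u '' Metric.closedBall x ε) :=
  essInf_restrict_eq_of_isGLB Metric.isOpen_ball hν hu <|
    (isGLB_iff_of_subset_of_subset_closure (image_mono Metric.ball_subset_closedBall)
      (image_closedBall_subset_closure_image_ball hu hx)).2 (isGLB_image_closedBall hε hu)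

theorem refTV_eq_advTV (hε : 0 ≤ ε) (hu : Continuous u)
    (hball : ∀ x : X, Metric.closedBall x ε ⊆ closure (Metric.ball x ε))
    {μ : Measure (X × Fin 2)} (hν : ∀ i, Metric.cthickening ε (classCond μ i).support ⊆ ν.support) :
    refTV ε μ ν u = advTV ε μ u := by
  rw [refTV, advTV]
  congr 1
  · refine extIntegral_congr_ae ?_
    filter_upwards [ae_ball_subset_of_cthickening_support_subset (hν 0)] with x hx
    rw [essSup_restrict_ball_eq_sSup hε hu (hball x) hx]
  · refine extIntegral_congr_ae ?_
    filter_upwards [ae_ball_subset_of_cthickening_support_subset (hν 1)] with x hx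
    rw [essInf_restrict_ball_eq_sInf hε hu (hball x) hx]

end Reference

section AscSlope

/-- The ascending slope of `u` at scale `ε`: the largest difference quotient with respect to `ε`
over the closed `ε`-ball. The descending slope is that of `-u`. -/
noncomputable def ascSlope {X : Type*} [MetricSpace X] (ε : ℝ) (u : X → ℝ) (x : X) : ℝ :=
  (sSup (u '' Metric.closedBall x ε) - u x) / ε

theorem grad_neg {X : Type*} (ε : ℝ) (u : X → ℝ) (x y : X) :
    grad ε (-u) x y = -grad ε u x y := by
  simp only [grad, Pi.neg_apply]
  ring

theorem continuous_grad {X : Type*} [TopologicalSpace X] (ε : ℝ) {u : X → ℝ} (hu : Continuous u)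
    (x : X) : Continuous (grad ε u x) :=
  (hu.sub continuous_const).div_const ε

variable {X : Type*} [MetricSpace X] {ε : ℝ} {u : X → ℝ}

theorem ascSlope_neg (ε : ℝ) (u : X → ℝ) (x : X) :
    ascSlope ε (-u) x = (u x - sInf (u '' Metric.closedBall x ε)) / ε := by
  have himage : (-u) '' Metric.closedBall x ε = -(u '' Metric.closedBall x ε) := by
    rw [← image_neg_eq_neg, image_image]
    rfl
  rw [ascSlope, himage, Real.sSup_neg, Pi.neg_apply]
  ring

theorem advTV_eq [MeasurableSpace X] (ε : ℝ) (μ : Measure (X × Fin 2)) (u : X → ℝ) :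
    advTV ε μ u =
      extIntegral (classCond μ 0) (ascSlope ε u) +
        extIntegral (classCond μ 1) (ascSlope ε (-u)) := by
  simp only [funext (ascSlope_neg ε u)]
  rfl

variable [ProperSpace X]

theorem grad_le_ascSlope (hε : 0 < ε) (hu : Continuous u) {x y : X}
    (hy : y ∈ Metric.closedBall x ε) : grad ε u x y ≤ ascSlope ε u x :=
  div_le_div_of_nonneg_right
    (sub_le_sub_right ((isLUB_image_closedBall hε.le hu).1 (mem_image_of_mem u hy)) _) hε.le

theorem ascSlope_nonneg (hε : 0 < ε) (hu : Continuous u) : 0 ≤ ascSlope ε u := fun x => by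
  simpa [grad] using grad_le_ascSlope hε hu (Metric.mem_closedBall_self hε.le : x ∈ _)

variable [MeasurableSpace X] [BorelSpace X]

theorem exists_measurable_grad_eq_ascSlope (hε : 0 ≤ ε) (hu : Continuous u) :
    ∃ T : X → X, Measurable T ∧
      ∀ x, T x ∈ Metric.closedBall x ε ∧ grad ε u x (T x) = ascSlope ε u x := by
  obtain ⟨T, hT, hmax⟩ :=
    ((isMeasurableCorrespondence_closedBall hε).argminSet hu.neg).exists_measurable_selection
  refine ⟨T, hT, fun x => ⟨(hmax x).1, ?_⟩⟩
  have hgreatest : IsGreatest (u '' Metric.closedBall x ε) (u (T x)) :=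
    ⟨mem_image_of_mem u (hmax x).1,
      forall_mem_image.2 fun y hy => neg_le_neg_iff.1 ((hmax x).2 y hy)⟩
  rw [grad, ascSlope, hgreatest.csSup_eq]

theorem measurable_ascSlope (hε : 0 ≤ ε) (hu : Continuous u) : Measurable (ascSlope ε u) := by
  obtain ⟨T, hT, hslope⟩ := exists_measurable_grad_eq_ascSlope hε hu
  rw [← funext fun x => (hslope x).2]
  exact ((hu.measurable.comp hT).sub hu.measurable).div_const ε

end AscSlope

section Walk

variable {X : Type*} [MetricSpace X] [MeasurableSpace X] {ε : ℝ}

section Dirac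

variable [MeasurableSingletonClass X] [Nonempty X] {T : X → X} (hT : Measurable T)

/-- The deterministic random walk that jumps from `x` to `T x`. -/
noncomputable def diracWalk : RandomWalk X where
  toKernel := Kernel.deterministic T hT
  isMarkov := inferInstance
  firstMoment := ⟨Classical.arbitrary X, fun x => by
    rw [Kernel.deterministic_apply, lintegral_dirac]
    exact edist_lt_top _ _⟩

theorem integral_diracWalk (f : X → ℝ) (x : X) :
    ∫ y, f y ∂((diracWalk hT).toKernel x) = f (T x) := by
  rw [diracWalk, Kernel.deterministic_apply, integral_dirac]

theorem diracWalk_mem_testWalks (h : ∀ x, T x ∈ Metric.closedBall x ε) (ρ : Measure X) :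
    diracWalk hT ∈ testWalks ε ρ := by
  rw [testWalks, mem_ofPred_eq]
  refine .of_forall fun x => Measure.support_subset_of_isClosed Metric.isClosed_closedBall ?_
  rw [diracWalk, Kernel.deterministic_apply, ae_dirac_eq]
  exact h x

end Dirac

theorem ae_mem_closedBall_of_mem_testWalks [SecondCountableTopology X] {ρ : Measure X}
    {m : RandomWalk X} (hm : m ∈ testWalks ε ρ) :
    ∀ᵐ x ∂ρ, ∀ᵐ y ∂(m.toKernel x), y ∈ Metric.closedBall x ε := by
  filter_upwards [hm] with x hx
  filter_upwards [(m.toKernel x).support_mem_ae] with y hy using hx hy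

theorem integrable_of_continuous_of_ae_mem_isCompact {Y : Type*} [TopologicalSpace Y] [T2Space Y]
    [MeasurableSpace Y] [BorelSpace Y] {κ : Measure Y} [IsFiniteMeasureOnCompacts κ] {K : Set Y}
    {f : Y → ℝ} (hf : Continuous f) (hK : IsCompact K) (h : ∀ᵐ y ∂κ, y ∈ K) : Integrable f κ := by
  rw [← Measure.restrict_eq_self_of_ae_mem h]
  exact hf.continuousOn.integrableOn_compact hK

variable [ProperSpace X] [BorelSpace X] {ρ₀ ρ : Measure X} {u : X → ℝ}

theorem ae_integrable_grad (hu : Continuous u) {m : RandomWalk X} (hm : m ∈ testWalks ε ρ) :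
    ∀ᵐ x ∂ρ, Integrable (grad ε u x) (m.toKernel x) := by
  filter_upwards [ae_mem_closedBall_of_mem_testWalks hm] with x hx
  exact integrable_of_continuous_of_ae_mem_isCompact (continuous_grad ε hu x)
    (isCompact_closedBall x ε) hx

theorem ae_integral_grad_le_ascSlope (hε : 0 < ε) (hu : Continuous u) {m : RandomWalk X}
    (hm : m ∈ testWalks ε ρ) :
    ∀ᵐ x ∂ρ, ∫ y, grad ε u x y ∂(m.toKernel x) ≤ ascSlope ε u x := by
  filter_upwards [ae_mem_closedBall_of_mem_testWalks hm, ae_integrable_grad hu hm] with x hx hint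
  exact (convex_Iic _).integral_mem isClosed_Iic
    (hx.mono fun _ hy => grad_le_ascSlope hε hu hy) hint

variable [Nonempty X]

theorem exists_mem_testWalks_integral_grad_eq_ascSlope (hε : 0 ≤ ε) (hu : Continuous u)
    (ρ : Measure X) :
    ∃ m ∈ testWalks ε ρ, ∀ x, ∫ y, grad ε u x y ∂(m.toKernel x) = ascSlope ε u x := by
  obtain ⟨T, hT, hslope⟩ := exists_measurable_grad_eq_ascSlope hε hu
  refine ⟨diracWalk hT, diracWalk_mem_testWalks hT (fun x => (hslope x).1) ρ, fun x => ?_⟩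
  rw [integral_diracWalk, (hslope x).2]

theorem isGreatest_extIntegral_grad (hε : 0 < ε) (hu : Continuous u) (hρ : ρ₀ ≪ ρ) :
    IsGreatest
      ((fun m : RandomWalk X => extIntegral ρ₀ fun x => ∫ y, grad ε u x y ∂(m.toKernel x)) ''
        testWalks ε ρ)
      (extIntegral ρ₀ (ascSlope ε u)) := by
  constructor
  · obtain ⟨m, hm, hslope⟩ := exists_mem_testWalks_integral_grad_eq_ascSlope hε.le hu ρ
    exact ⟨m, hm, by simp only [hslope]⟩
  · rintro _ ⟨m, hm, rfl⟩
    exact extIntegral_mono_ae (hρ.ae_le (ae_integral_grad_le_ascSlope hε hu hm))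

theorem classCond_absolutelyContinuous_total {X : Type*} [MeasurableSpace X]
    (μ : Measure (X × Fin 2)) (i : Fin 2) : classCond μ i ≪ total μ := by
  fin_cases i
  · exact Measure.AbsolutelyContinuous.rfl.add_right _
  · exact Measure.AbsolutelyContinuous.rfl.add_right' _

theorem isGreatest_advTV_extIntegral_grad (hε : 0 < ε) (hu : Continuous u)
    (μ : Measure (X × Fin 2)) :
    IsGreatest
      ((fun m : RandomWalk X × RandomWalk X =>
          extIntegral (classCond μ 0) (fun x => ∫ y, grad ε u x y ∂(m.1.toKernel x))
            + extIntegral (classCond μ 1) (fun x => ∫ y, -grad ε u x y ∂(m.2.toKernel x))) ''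
        (testWalks ε (total μ) ×ˢ testWalks ε (total μ)))
      (advTV ε μ u) := by
  have h := IsGreatest.image2 (fun _ => add_left_mono) (fun _ => add_right_mono)
    (isGreatest_extIntegral_grad hε hu (classCond_absolutelyContinuous_total μ 0))
    (isGreatest_extIntegral_grad hε hu.neg (classCond_absolutelyContinuous_total μ 1))
  rw [image2_image_left, image2_image_right, ← image_prod] at h
  rw [advTV_eq]
  simpa only [grad_neg] using h

end Walk

section Density

theorem integral_toReal_kernel_rnDeriv_mul {α γ : Type*} [MeasurableSpace α] [MeasurableSpace γ]
    [MeasurableSpace.CountableOrCountablyGenerated α γ] {κ η : Kernel α γ} [IsFiniteKernel κ]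
    [IsFiniteKernel η] {a : α} (h : κ a ≪ η a) (f : γ → ℝ) :
    ∫ y, (Kernel.rnDeriv κ η a y).toReal * f y ∂(η a) = ∫ y, f y ∂(κ a) := by
  rw [← integral_toReal_rnDeriv_mul h]
  refine integral_congr_ae ?_
  filter_upwards [Kernel.rnDeriv_eq_rnDeriv_measure (κ := κ) (η := η) (a := a)] with y hy
  rw [hy]

theorem integrable_toReal_kernel_rnDeriv_mul {α γ : Type*} [MeasurableSpace α]
    [MeasurableSpace γ] [MeasurableSpace.CountableOrCountablyGenerated α γ] {κ η : Kernel α γ}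
    [IsFiniteKernel κ] [IsFiniteKernel η] {a : α} (h : κ a ≪ η a) {f : γ → ℝ}
    (hf : Integrable f (κ a)) :
    Integrable (fun y => (Kernel.rnDeriv κ η a y).toReal * f y) (η a) := by
  refine ((integrable_toReal_rnDeriv_mul_iff h).2 hf).congr ?_
  filter_upwards [Kernel.rnDeriv_eq_rnDeriv_measure (κ := κ) (η := η) (a := a)] with y hy
  rw [hy]

variable {X : Type*} [MetricSpace X] [MeasurableSpace X] [BorelSpace X]

theorem absolutelyContinuous_avgWalk_left (m₀ m₁ : RandomWalk X) (x : X) :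
    m₀.toKernel x ≪ (avgWalk m₀ m₁).toKernel x :=
  (Measure.AbsolutelyContinuous.rfl.add_right _).trans
    (Measure.absolutelyContinuous_smul (by simp))

theorem absolutelyContinuous_avgWalk_right (m₀ m₁ : RandomWalk X) (x : X) :
    m₁.toKernel x ≪ (avgWalk m₀ m₁).toKernel x :=
  (Measure.AbsolutelyContinuous.rfl.add_right' _).trans
    (Measure.absolutelyContinuous_smul (by simp))

variable [ProperSpace X] {ε : ℝ} {u : X → ℝ} {m₀ m₁ : RandomWalk X}

theorem integral_mul_density (μ : Measure (X × Fin 2)) {x : X} {f : X → ℝ}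
    (h₀ : Integrable f (m₀.toKernel x)) (h₁ : Integrable f (m₁.toKernel x)) :
    ∫ y, f y * density μ m₀ m₁ x y ∂((avgWalk m₀ m₁).toKernel x) =
      ((classCond μ 0).rnDeriv (total μ) x).toReal * ∫ y, f y ∂(m₀.toKernel x) -
      ((classCond μ 1).rnDeriv (total μ) x).toReal * ∫ y, f y ∂(m₁.toKernel x) := by
  have hac₀ := absolutelyContinuous_avgWalk_left m₀ m₁ x
  have hac₁ := absolutelyContinuous_avgWalk_right m₀ m₁ x
  simp only [density, mul_comm (f _), sub_mul, mul_assoc]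
  rw [integral_sub ((integrable_toReal_kernel_rnDeriv_mul hac₀ h₀).const_mul _)
    ((integrable_toReal_kernel_rnDeriv_mul hac₁ h₁).const_mul _), integral_const_mul,
    integral_const_mul, integral_toReal_kernel_rnDeriv_mul hac₀,
    integral_toReal_kernel_rnDeriv_mul hac₁]

theorem ae_integral_grad_mul_density (hu : Continuous u) {μ : Measure (X × Fin 2)}
    (h₀ : m₀ ∈ testWalks ε (total μ)) (h₁ : m₁ ∈ testWalks ε (total μ)) :
    ∀ᵐ x ∂(total μ), ∫ y, grad ε u x y * density μ m₀ m₁ x y ∂((avgWalk m₀ m₁).toKernel x) =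
      ((classCond μ 0).rnDeriv (total μ) x).toReal * ∫ y, grad ε u x y ∂(m₀.toKernel x) +
      ((classCond μ 1).rnDeriv (total μ) x).toReal * ∫ y, grad ε (-u) x y ∂(m₁.toKernel x) := by
  filter_upwards [ae_integrable_grad hu h₀, ae_integrable_grad hu h₁] with x hx₀ hx₁
  simp only [integral_mul_density μ hx₀ hx₁, grad_neg, integral_neg, mul_neg, sub_eq_add_neg]

instance {X : Type*} [MeasurableSpace X] (μ : Measure (X × Fin 2)) [IsFiniteMeasure μ] :
    IsFiniteMeasure (total μ) :=
  inferInstanceAs (IsFiniteMeasure (_ + _))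

theorem extIntegral_total_rnDeriv_mul_ascSlope (hε : 0 < ε) (hu : Continuous u)
    (μ : Measure (X × Fin 2)) [IsFiniteMeasure μ] :
    extIntegral (total μ) (fun x =>
        ((classCond μ 0).rnDeriv (total μ) x).toReal * ascSlope ε u x +
        ((classCond μ 1).rnDeriv (total μ) x).toReal * ascSlope ε (-u) x) =
      advTV ε μ u := by
  have hm := measurable_ascSlope hε.le hu
  have hm' := measurable_ascSlope hε.le hu.neg
  rw [advTV_eq,
    ← extIntegral_rnDeriv_mul (classCond_absolutelyContinuous_total μ 0) hm.aemeasurable,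
    ← extIntegral_rnDeriv_mul (classCond_absolutelyContinuous_total μ 1) hm'.aemeasurable]
  exact extIntegral_add_of_nonneg
    (fun x => mul_nonneg ENNReal.toReal_nonneg (ascSlope_nonneg hε hu x))
    (fun x => mul_nonneg ENNReal.toReal_nonneg (ascSlope_nonneg hε hu.neg x))
    ((Measure.measurable_rnDeriv _ _).ennreal_toReal.mul hm).aemeasurable

theorem isGreatest_advTV_extIntegral_grad_mul_density [Nonempty X] (hε : 0 < ε)
    (hu : Continuous u) (μ : Measure (X × Fin 2)) [IsFiniteMeasure μ] :
    IsGreatest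
      ((fun m : RandomWalk X × RandomWalk X =>
          extIntegral (total μ)
            (fun x => ∫ y, grad ε u x y * density μ m.1 m.2 x y
              ∂((avgWalk m.1 m.2).toKernel x))) ''
        (testWalks ε (total μ) ×ˢ testWalks ε (total μ)))
      (advTV ε μ u) := by
  rw [← extIntegral_total_rnDeriv_mul_ascSlope hε hu μ]
  constructor
  · obtain ⟨m₀, h₀, hslope₀⟩ :=
      exists_mem_testWalks_integral_grad_eq_ascSlope hε.le hu (total μ)
    obtain ⟨m₁, h₁, hslope₁⟩ :=
      exists_mem_testWalks_integral_grad_eq_ascSlope hε.le hu.neg (total μ)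
    refine ⟨(m₀, m₁), ⟨h₀, h₁⟩, extIntegral_congr_ae ?_⟩
    filter_upwards [ae_integral_grad_mul_density hu h₀ h₁] with x hx
    rw [hx, hslope₀, hslope₁]
  · rintro _ ⟨⟨m₀, m₁⟩, ⟨h₀, h₁⟩, rfl⟩
    refine extIntegral_mono_ae ?_
    filter_upwards [ae_integral_grad_mul_density hu h₀ h₁,
      ae_integral_grad_le_ascSlope hε hu h₀, ae_integral_grad_le_ascSlope hε hu.neg h₁]
      with x hx hx₀ hx₁
    rw [hx]
    gcongr

end Density

section Divergence

section Bind

variable {α β E : Type*} [MeasurableSpace α] [MeasurableSpace β] [NormedAddCommGroup E]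
  [NormedSpace ℝ E] {ρ : Measure α} {κ : Kernel α β} {f : β → E}

theorem integrable_integral_of_integrable_bind (hf : Integrable f (ρ.bind κ)) :
    Integrable (fun x => ∫ y, f y ∂(κ x)) ρ := by
  rw [Measure.comp_eq_comp_const_apply] at hf
  exact hf.integral_comp

theorem integral_bind (hf : Integrable f (ρ.bind κ)) :
    ∫ y, f y ∂(ρ.bind κ) = ∫ x, ∫ y, f y ∂(κ x) ∂ρ := by
  rw [Measure.comp_eq_comp_const_apply] at hf ⊢
  exact Kernel.integral_comp hf

end Bind

theorem integrable_toSignedMeasure {α : Type*} [MeasurableSpace α] {ρ : Measure α}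
    [IsFiniteMeasure ρ] {f : α → ℝ} (hf : Integrable f ρ) : ρ.toSignedMeasure.Integrable f := by
  rwa [VectorMeasure.Integrable, Measure.variation_toSignedMeasure]

theorem integral_grad {X : Type*} [MeasurableSpace X] (ε : ℝ) {κ : Measure X}
    [IsProbabilityMeasure κ] {f : X → ℝ} (hf : Integrable f κ) (x : X) :
    ∫ y, grad ε f x y ∂κ = ε⁻¹ * (∫ y, f y ∂κ - f x) := by
  simp only [grad, div_eq_inv_mul]
  rw [integral_const_mul, integral_sub hf (integrable_const _), integral_const, probReal_univ,
    one_smul]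

variable {X : Type*} [MetricSpace X] [MeasurableSpace X] {ρ : Measure X} {m : RandomWalk X}
  {f : X → ℝ}

theorem ae_integral_grad_eq (ε : ℝ) (hm : Integrable f (ρ.bind m.toKernel)) :
    (fun x => ∫ y, grad ε f x y ∂(m.toKernel x)) =ᵐ[ρ]
      fun x => ε⁻¹ * (∫ y, f y ∂(m.toKernel x) - f x) := by
  filter_upwards [Measure.ae_integrable_of_integrable_comp hm] with x hx using integral_grad ε hx x

theorem integrable_integral_grad (ε : ℝ) (hρ : Integrable f ρ)
    (hm : Integrable f (ρ.bind m.toKernel)) :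
    Integrable (fun x => ∫ y, grad ε f x y ∂(m.toKernel x)) ρ :=
  (((integrable_integral_of_integrable_bind hm).sub hρ).const_mul _).congr
    (ae_integral_grad_eq ε hm).symm

variable [IsFiniteMeasure ρ]

theorem integrable_walkDiv (ε : ℝ) (hρ : Integrable f ρ) (hm : Integrable f (ρ.bind m.toKernel)) :
    (walkDiv ε ρ m).Integrable f :=
  ((integrable_toSignedMeasure hρ).sub_vectorMeasure
    (integrable_toSignedMeasure hm)).smul_vectorMeasure _

theorem integral_walkDiv (ε : ℝ) (hρ : Integrable f ρ) (hm : Integrable f (ρ.bind m.toKernel)) :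
    ∫ᵛ x, f x ∂<•(walkDiv ε ρ m) = -∫ x, ∫ y, grad ε f x y ∂(m.toKernel x) ∂ρ := by
  rw [walkDiv, VectorMeasure.integral_smul_vectorMeasure,
    VectorMeasure.integral_sub_vectorMeasure (integrable_toSignedMeasure hρ)
      (integrable_toSignedMeasure hm), VectorMeasure.integral_toSignedMeasure,
    VectorMeasure.integral_toSignedMeasure, integral_bind hm,
    integral_congr_ae (ae_integral_grad_eq ε hm), integral_const_mul,
    integral_sub (integrable_integral_of_integrable_bind hm) hρ, smul_eq_mul]
  ring

theorem neg_integral_pairDiv [OpensMeasurableSpace X] (ε : ℝ) (μ : Measure (X × Fin 2))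
    [IsFiniteMeasure μ] (m₀ m₁ : RandomWalk X) (u : X →ᵇ ℝ) :
    ((-(∫ᵛ x, u x ∂<•(pairDiv ε μ m₀ m₁)) : ℝ) : EReal) =
      extIntegral (classCond μ 0) (fun x => ∫ y, grad ε u x y ∂(m₀.toKernel x)) +
        extIntegral (classCond μ 1) (fun x => ∫ y, -grad ε u x y ∂(m₁.toKernel x)) := by
  have hu (ρ : Measure X) [IsFiniteMeasure ρ] : Integrable u ρ := u.integrable ρ
  simp only [integral_neg]
  rw [extIntegral_of_integrable (integrable_integral_grad ε (hu _) (hu _)),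
    extIntegral_of_integrable (integrable_integral_grad ε (hu _) (hu _)).fun_neg,
    ← EReal.coe_add, pairDiv, VectorMeasure.integral_sub_vectorMeasure
      (integrable_walkDiv ε (hu _) (hu _)) (integrable_walkDiv ε (hu _) (hu _)),
    integral_walkDiv ε (hu _) (hu _), integral_walkDiv ε (hu _) (hu _), integral_neg]
  congr 1
  ring

end Divergence

end AdvTV

theorem mainTheorem1_general {X : Type*} [MetricSpace X] [ProperSpace X] [MeasurableSpace X]
    [BorelSpace X] [Nonempty X] {ε : ℝ} (hε : 0 < ε) (μ : Measure (X × Fin 2))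
    [IsFiniteMeasure μ] :
    (∀ u : C(X, ℝ),
      ((∀ x : X, Metric.closedBall x ε ⊆ closure (Metric.ball x ε)) → ∀ ν : Measure X,
        (∀ i, Metric.cthickening ε (AdvTV.classCond μ i).support ⊆ ν.support) →
        AdvTV.refTV ε μ ν u = AdvTV.advTV ε μ u) ∧
      IsGreatest
        ((fun m : AdvTV.RandomWalk X × AdvTV.RandomWalk X =>
            AdvTV.extIntegral (AdvTV.classCond μ 0)
                (fun x => ∫ y, AdvTV.grad ε u x y ∂(m.1.toKernel x))
              + AdvTV.extIntegral (AdvTV.classCond μ 1)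
                (fun x => ∫ y, -AdvTV.grad ε u x y ∂(m.2.toKernel x))) ''
          (AdvTV.testWalks ε (AdvTV.total μ) ×ˢ AdvTV.testWalks ε (AdvTV.total μ)))
        (AdvTV.advTV ε μ u) ∧
      IsGreatest
        ((fun m : AdvTV.RandomWalk X × AdvTV.RandomWalk X =>
            AdvTV.extIntegral (AdvTV.total μ)
              (fun x => ∫ y, AdvTV.grad ε u x y * AdvTV.density μ m.1 m.2 x y
                ∂((AdvTV.avgWalk m.1 m.2).toKernel x))) ''
          (AdvTV.testWalks ε (AdvTV.total μ) ×ˢ AdvTV.testWalks ε (AdvTV.total μ)))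
        (AdvTV.advTV ε μ u)) ∧
    ∀ u : X →ᵇ ℝ,
      IsGreatest
        ((fun m : AdvTV.RandomWalk X × AdvTV.RandomWalk X =>
            ((-(∫ᵛ x, u x ∂<•(AdvTV.pairDiv ε μ m.1 m.2)) : ℝ) : EReal)) ''
          (AdvTV.testWalks ε (AdvTV.total μ) ×ˢ AdvTV.testWalks ε (AdvTV.total μ)))
        (AdvTV.advTV ε μ u) := by
  refine ⟨fun u => ⟨fun hball ν hν => AdvTV.refTV_eq_advTV hε.le u.continuous hball hν,
    AdvTV.isGreatest_advTV_extIntegral_grad hε u.continuous μ,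
    AdvTV.isGreatest_advTV_extIntegral_grad_mul_density hε u.continuous μ⟩, fun u => ?_⟩
  simp only [AdvTV.neg_integral_pairDiv]
  exact AdvTV.isGreatest_advTV_extIntegral_grad hε u.continuous μ

theorem mainTheorem1 {X : Type*} [MetricSpace X] [ProperSpace X] [MeasurableSpace X]
    [BorelSpace X] (ε : ℝ) (hε : 0 < ε) (hT : AdvTV.ShrinkingMaps X ε)
    (μ : Measure (X × Fin 2)) [IsProbabilityMeasure μ] :
    (∀ u : C(X, ℝ),
      (∀ ν : Measure X, AdvTV.IsReferenceMeasure ε μ ν →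
        AdvTV.refTV ε μ ν u = AdvTV.advTV ε μ u) ∧
      IsGreatest
        ((fun m : AdvTV.RandomWalk X × AdvTV.RandomWalk X =>
            AdvTV.extIntegral (AdvTV.classCond μ 0)
                (fun x => ∫ y, AdvTV.grad ε u x y ∂(m.1.toKernel x))
              + AdvTV.extIntegral (AdvTV.classCond μ 1)
                (fun x => ∫ y, -AdvTV.grad ε u x y ∂(m.2.toKernel x))) ''
          (AdvTV.testWalks ε (AdvTV.total μ) ×ˢ AdvTV.testWalks ε (AdvTV.total μ)))
        (AdvTV.advTV ε μ u) ∧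
      IsGreatest
        ((fun m : AdvTV.RandomWalk X × AdvTV.RandomWalk X =>
            AdvTV.extIntegral (AdvTV.total μ)
              (fun x => ∫ y, AdvTV.grad ε u x y * AdvTV.density μ m.1 m.2 x y
                ∂((AdvTV.avgWalk m.1 m.2).toKernel x))) ''
          (AdvTV.testWalks ε (AdvTV.total μ) ×ˢ AdvTV.testWalks ε (AdvTV.total μ)))
        (AdvTV.advTV ε μ u)) ∧
    ∀ u : X →ᵇ ℝ,
      IsGreatest
        ((fun m : AdvTV.RandomWalk X × AdvTV.RandomWalk X =>
            ((-(∫ᵛ x, u x ∂<•(AdvTV.pairDiv ε μ m.1 m.2)) : ℝ) : EReal)) ''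
          (AdvTV.testWalks ε (AdvTV.total μ) ×ˢ AdvTV.testWalks ε (AdvTV.total μ)))
        (AdvTV.advTV ε μ u) := by
  have hX : Nonempty X := (nonempty_of_isProbabilityMeasure μ).map Prod.fst
  obtain ⟨h, hbounded⟩ := mainTheorem1_general hε μ
  exact ⟨fun u => ⟨fun ν hν =>
    (h u).1 (hT.closedBall_subset_closure_ball hε) ν hν.support_subset, (h u).2⟩, hbounded⟩
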